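/- Let $n$ be a natural number and let $K \subsetneq 2^{[n]}$ be a simplicial complex (closed under passing to subsets, with $\emptyset \in K$). Let $K^\circ = \{[n]\setminus I : I \notin K\}$ be its Alexander dual, and let $\mathrm{Bier}(K) = \{S \uplus T : S \in K,\ T \in K^\circ,\ S \cap T = \emptyset\}$, an abstract simplicial complex on two disjoint copies of $[n]$. In $\mathbb{R}^n$ put $u = e_1 + \dots + e_n$, $H_0 = \{x \in \mathbb{R}^n : \sum_i x_i = 0\}$ and $\delta_i = e_i - \frac{u}{n} \in H_0$, and let $$\mathcal{R}_{\pm\delta}(\mathrm{Bier}(K)) = \{\mathrm{Conv}(\{\delta_i : i \in S\} \cup \{-\delta_j : j \in T\}) : S \uplus T \in \mathrm{Bier}(K)\}.$$ Then: 1. $\mathcal{R}_{\pm\delta}(\mathrm{Bier}(K))$ is a geometric realization of $\mathrm{Bier}(K)$ in $H_0$: its nonempty members are the simplices of a geometric simplicial complex, and sending the vertex $i$ of the first copy of $[n]$ to $\delta_i$ and the vertex $j$ of the second copy to $-\delta_j$ defines an isomorphism of $\mathrm{Bier}(K)$ onto that complex. 2. This realization is a sphere starshaped about the origin: the union $X \subset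 H_0$ of its simplices is homeomorphic to the unit sphere of $H_0$, $0 \notin X$, and $[0,x] \cap [0,y] = \{0\}$ for all distinct $x, y \in X$. 3. The cones with apex $0$ over the simplices of $\mathcal{R}_{\pm\delta}(\mathrm{Bier}(K))$ (the cone over the empty simplex being $\{0\}$) form a complete simplicial fan in $H_0$: a finite family of simplicial cones, closed under taking faces, that covers $H_0$ and in which any two cones intersect in a common face that again belongs to the family. 4. The barycentric (shore) subdivision of this family of cones equals the fan of the barycentric subdivision of the boundary of the simplex $\Delta_\delta = \mathrm{Conv}\{\delta_1, \dots, \delta_n\}$. That is, writing $\nu_{\pm\delta}(A) = \frac{1}{|A|}\sum_{i \in A} (\pm\delta_i)$, the family of all cones positively spanned by $\nu_\delta(S_1), \dots, \nu_\delta(S_p), \nu_{-\delta}(T_1), \dots, \nu_{-\delta}(T_q)$, where $p, q \ge 0$, $\emptyset \ne S_1 \subsetneq \dots \subsetneq S_p \subseteq S$ and $\emptyset \ne T_1 \subsetneq \dots \subsetneq T_q \subseteq T$ for some $S \uplus T \in \mathrm{Bier}(K)$, equals the family of all cones positively spanned by $\nu_\delta(A_1), \dots, \nu_\delta(A_m)$,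 where $m \ge 0$ and $\emptyset \ne A_1 \subsetneq \dots \subsetneq A_m \subsetneq [n]$. -/

import Mathlib

namespace BierSphere

/-! ### Abstract simplicial complexes

An abstract simplicial complex on the vertex set `α` (with the empty set as a face) is a lower set
of finite subsets of `α` that contains `∅`. The full complex `2^α` is `⊤`. -/

/-- The Alexander dual `K° = {Iᶜ | I ∉ K}`, that is, `J ∈ K°` if and only if `Jᶜ ∉ K`. -/
def alexanderDual {n : ℕ} (K : LowerSet (Finset (Fin n))) : LowerSet (Finset (Fin n)) where
  carrier := {J | Jᶜ ∉ K}
  lower' := fun _ _ h hA hB => hA (K.lower (Finset.compl_subset_compl.mpr h) hB)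

/-- The deleted join `{A ⊎ B | A ∈ K, B ∈ L, A ∩ B = ∅}`, with the disjoint union `A ⊎ B` taken
in `α ⊕ α`. -/
def deletedJoin {α : Type*} (K L : LowerSet (Finset α)) : LowerSet (Finset (α ⊕ α)) where
  carrier := {s | s.toLeft ∈ K ∧ s.toRight ∈ L ∧ Disjoint s.toLeft s.toRight}
  lower' := fun _ _ h hA =>
    ⟨K.lower (Finset.toLeft_subset_toLeft h) hA.1, L.lower (Finset.toRight_subset_toRight h) hA.2.1,
      hA.2.2.mono (Finset.toLeft_subset_toLeft h) (Finset.toRight_subset_toRight h)⟩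

theorem mem_deletedJoin_iff {α : Type*} {K L : LowerSet (Finset α)} {s : Finset (α ⊕ α)} :
    s ∈ deletedJoin K L ↔ ∃ A ∈ K, ∃ B ∈ L, Disjoint A B ∧ s = A.disjSum B := by
  constructor
  · rintro ⟨h1, h2, h3⟩
    exact ⟨_, h1, _, h2, h3, Finset.toLeft_disjSum_toRight.symm⟩
  · rintro ⟨A, hA, B, hB, hAB, rfl⟩
    refine ⟨?_, ?_, ?_⟩ <;> simpa

/-- The Bier sphere `Bier(K) = K *_Δ K°`, an abstract simplicial complex on `[n] ⊎ [n]`. -/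
def bier {n : ℕ} (K : LowerSet (Finset (Fin n))) : LowerSet (Finset (Fin n ⊕ Fin n)) :=
  deletedJoin K (alexanderDual K)

/-! ### The canonical realization -/

/-- The hyperplane `H₀ = {x ∈ ℝⁿ | ∑ xᵢ = 0}`. -/
def H0 (n : ℕ) : Submodule ℝ (EuclideanSpace ℝ (Fin n)) where
  carrier := {x | ∑ i, x i = 0}
  add_mem' := by
    intro a b ha hb
    simp only [Set.mem_ofPred_eq, PiLp.add_apply, Finset.sum_add_distrib] at *
    rw [ha, hb, add_zero]
  zero_mem' := by simp
  smul_mem' := by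
    intro c x hx
    simp only [Set.mem_ofPred_eq, PiLp.smul_apply, smul_eq_mul, ← Finset.mul_sum] at *
    rw [hx, mul_zero]

/-- The vector `u = e₁ + ⋯ + eₙ`. -/
noncomputable def allOnes (n : ℕ) : EuclideanSpace ℝ (Fin n) :=
  ∑ i, EuclideanSpace.single i (1 : ℝ)

/-- The vectors `δᵢ = eᵢ - u / n`, as elements of `H₀`. -/
noncomputable def delta {n : ℕ} (i : Fin n) : H0 n :=
  ⟨EuclideanSpace.single i (1 : ℝ) - (n : ℝ)⁻¹ • allOnes n, by
    have hn : (n : ℝ) ≠ 0 := Nat.cast_ne_zero.mpr (Nat.ne_of_gt i.pos)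
    change ∑ j, (EuclideanSpace.single i (1 : ℝ) - (n : ℝ)⁻¹ • allOnes n) j = 0
    have h : ∀ j, allOnes n j = 1 := by
      intro j
      simp [allOnes, Finset.sum_apply, Pi.single_apply]
    simp [h, Finset.sum_sub_distrib, hn]⟩

/-- `R_b(S) = Conv {b_i | i ∈ S}`. -/
def realizedSimplex {n : ℕ} {V : Type*} [AddCommGroup V] [Module ℝ V] (b : Fin n → V)
    (S : Finset (Fin n)) : Set V :=
  convexHull ℝ (b '' (S : Set (Fin n)))

/-- `R_{±δ}(Bier(K))`: the family of all `R_δ(S) * R_{-δ}(T) = Conv (R_δ(S) ∪ R_{-δ}(T))` with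
`S ⊎ T ∈ Bier(K)` (for `S = T = ∅` this is the empty simplex). -/
def canonicalRealization {n : ℕ} (K : LowerSet (Finset (Fin n))) : Set (Set (H0 n)) :=
  {C | ∃ s ∈ bier K, C = convexHull ℝ
    (realizedSimplex delta s.toLeft ∪ realizedSimplex (fun i => -delta i) s.toRight)}

/-- The family `𝓡` of simplices in `V` is a geometric realization of the abstract simplicial
complex `𝒦`, with the vertex `a` of `𝒦` placed at `f a`: the nonempty members of `𝓡` are the
simplices of a geometric simplicial complex `G` in `V` (affinely independent vertices, and any two
simplices intersect in a common face), and `f` is an isomorphism of `𝒦` onto the vertex scheme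
of `G`. -/
def IsGeometricRealization {α V : Type*} [AddCommGroup V] [Module ℝ V]
    (𝓡 : Set (Set V)) (𝒦 : LowerSet (Finset α)) (f : α → V) : Prop :=
  ∃ G : Geometry.SimplicialComplex ℝ V,
    𝓡 \ {∅} = (fun t : Finset V => convexHull ℝ (t : Set V)) '' G.faces ∧
    Set.InjOn f {a | {a} ∈ 𝒦} ∧
    G.faces = {t : Finset V | ∃ s ∈ 𝒦, s.Nonempty ∧ (t : Set V) = f '' (s : Set α)}

/-- `X ⊆ V` is a topological sphere of dimension `dim V - 1` that is starshaped about `c`: the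
point `c` is not in `X`, and the segments from `c` to distinct points of `X` meet only in `c`. -/
structure IsStarshapedSphere {V : Type*} [NormedAddCommGroup V] [NormedSpace ℝ V]
    (c : V) (X : Set V) : Prop where
  sphere : Nonempty (X ≃ₜ Metric.sphere (0 : V) 1)
  notMem : c ∉ X
  inter : ∀ x ∈ X, ∀ y ∈ X, x ≠ y → segment ℝ c x ∩ segment ℝ c y = {c}

/-! ### Fans -/

/-- A complete simplicial fan: a finite family of simplicial cones with apex `0`, closed under
taking faces, covering `V`, such that any two of its cones intersect in a common face, which again
belongs to the family. -/
structure IsCompleteSimplicialFan {V : Type*} [AddCommGroup V] [Module ℝ V]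
    (F : Set (PointedCone ℝ V)) : Prop where
  finite : F.Finite
  simplicial : ∀ C ∈ F, C.IsSimplicial
  face_mem : ∀ C ∈ F, ∀ D : PointedCone ℝ V, D.IsFaceOf C → D ∈ F
  inter : ∀ C ∈ F, ∀ D ∈ F, (C ⊓ D).IsFaceOf C ∧ (C ⊓ D).IsFaceOf D ∧ C ⊓ D ∈ F
  cover : ∀ x : V, ∃ C ∈ F, x ∈ C

/-- The cones with apex `0` over the simplices of `R_{±δ}(Bier(K))`; the cone over the empty
simplex is `{0}`. -/
def coneFamily {n : ℕ} (K : LowerSet (Finset (Fin n))) : Set (PointedCone ℝ (H0 n)) :=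
  (fun C : Set (H0 n) => PointedCone.hull ℝ C) '' canonicalRealization K

/-- The barycenter `ν_b(S)` of `R_b(S)`, for nonempty `S`. -/
noncomputable def barycenter {n : ℕ} {V : Type*} [AddCommGroup V] [Module ℝ V] (b : Fin n → V)
    (S : Finset (Fin n)) : V :=
  (S.card : ℝ)⁻¹ • ∑ i ∈ S, b i

/-- The shore subdivision of the family of cones over `R_{±δ}(Bier(K))`: the cones positively
spanned by `ν_δ(S₁), …, ν_δ(S_p), ν_{-δ}(T_q), …, ν_{-δ}(T₁)` for chains
`S₁ ⊂ ⋯ ⊂ S_p ⊆ S` and `T₁ ⊂ ⋯ ⊂ T_q ⊆ T` of nonempty sets (`p, q ≥ 0`), with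
`S ⊎ T ∈ Bier(K)`. -/
def shoreSubdivision {n : ℕ} (K : LowerSet (Finset (Fin n))) : Set (PointedCone ℝ (H0 n)) :=
  {C | ∃ s ∈ bier K, ∃ 𝒮 𝒯 : Set (Finset (Fin n)),
    IsChain (· ⊆ ·) 𝒮 ∧ (∀ A ∈ 𝒮, A.Nonempty ∧ A ⊆ s.toLeft) ∧
    IsChain (· ⊆ ·) 𝒯 ∧ (∀ B ∈ 𝒯, B.Nonempty ∧ B ⊆ s.toRight) ∧
    C = PointedCone.hull ℝ (barycenter delta '' 𝒮 ∪ barycenter (fun i => -delta i) '' 𝒯)}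

/-- The fan generated by the barycentric subdivision of the boundary of `Δ_δ = Conv {δᵢ}`: the
cones positively spanned by the barycenters of the members of a chain of nonempty proper faces. -/
def barycentricFan (n : ℕ) : Set (PointedCone ℝ (H0 n)) :=
  {C | ∃ 𝒜 : Set (Finset (Fin n)),
    IsChain (· ⊆ ·) 𝒜 ∧ (∀ A ∈ 𝒜, A.Nonempty ∧ A ≠ Finset.univ) ∧
    C = PointedCone.hull ℝ (barycenter delta '' 𝒜)}

end BierSphere

/-! Lowering a threshold `c` makes the superlevel sets of `x` grow from the empty set to `[n]`, so
they leave `K` at exactly one value: there is a unique `c` with `{xᵢ > c} ∈ K` and `{xᵢ ≥ c} ∉ K`.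
Then `S = {xᵢ > c}` and `T = {xᵢ < c}` give a face `S ⊎ T` of the Bier sphere. Since the `δᵢ` sum to
zero, `x = ∑ (xᵢ - c) δᵢ`, which is a nonnegative combination of the `δᵢ` on `S` and the `-δⱼ` on
`T`. Conversely, any such representation on a face reveals `c`, so it is unique. The level `c` is
1-Lipschitz in `x`, so the coefficients are continuous (`exists_isFanCoordinate`).

The first three claims follow formally from such coordinates `W`: a cone is where `W` vanishes off a
face, a simplex is the part of it with `∑ W = 1`, and the sphere is the unit level set of the
positively homogeneous function `∑ W`.

For the last claim, `ν_{-δ}(B)` is a positive multiple of `ν_δ(Bᶜ)` for nonempty proper `B`. A chain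
of proper faces splits into its members in `K` and the rest, whose complements form a chain in the
dual (`shoreSubdivision_eq`). -/

namespace BierSphere

/-! ### Coordinates of a complete simplicial fan -/

/-- `W` assigns to every vector `x` the coefficients of its unique representation as a nonnegative
combination of vectors `f a` whose support is a face of `𝒦`. -/
structure IsFanCoordinate {α V : Type*} [Fintype α] [AddCommGroup V] [Module ℝ V]
    (f : α → V) (𝒦 : LowerSet (Finset α)) (W : V → α → ℝ) : Prop where
  nonneg : ∀ x a, 0 ≤ W x a
  exists_support : ∀ x, ∃ s ∈ 𝒦, ∀ a ∉ s, W x a = 0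
  sum_eq : ∀ x, ∑ a, W x a • f a = x
  apply_sum : ∀ s ∈ 𝒦, ∀ w : α → ℝ, (∀ a, 0 ≤ w a) → (∀ a ∉ s, w a = 0) →
    W (∑ a, w a • f a) = w

namespace IsFanCoordinate

section Module

variable {α V : Type*} [Fintype α] [AddCommGroup V] [Module ℝ V]
  {f : α → V} {𝒦 : LowerSet (Finset α)} {W : V → α → ℝ} {s t : Finset α} {x y : V}

/-- `W` is only piecewise linear. On a common face, `W x + W y` is itself an admissible coefficient
vector for `x + y`, and uniqueness applies. -/
theorem apply_add (h : IsFanCoordinate f 𝒦 W) (hs : s ∈ 𝒦) (hx : ∀ a ∉ s, W x a = 0)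
    (hy : ∀ a ∉ s, W y a = 0) : W (x + y) = W x + W y := by
  have key := h.apply_sum s hs (W x + W y) (fun a => add_nonneg (h.nonneg x a) (h.nonneg y a))
    (fun a ha => by simp [hx a ha, hy a ha])
  simpa [add_smul, Finset.sum_add_distrib, h.sum_eq] using key

theorem apply_smul (h : IsFanCoordinate f 𝒦 W) {c : ℝ} (hc : 0 ≤ c) (x : V) :
    W (c • x) = c • W x := by
  obtain ⟨s, hs, hx⟩ := h.exists_support x
  have key := h.apply_sum s hs (c • W x) (fun a => mul_nonneg hc (h.nonneg x a))
    (fun a ha => by simp [hx a ha])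
  simpa [mul_smul, ← Finset.smul_sum, h.sum_eq] using key

theorem apply_zero (h : IsFanCoordinate f 𝒦 W) : W 0 = 0 := by
  simpa using h.apply_smul le_rfl 0

theorem apply_vertex [DecidableEq α] (h : IsFanCoordinate f 𝒦 W) (hs : s ∈ 𝒦) {a : α}
    (ha : a ∈ s) : W (f a) = Pi.single a 1 := by
  have key := h.apply_sum s hs (Pi.single a 1)
    (fun b => by by_cases hb : b = a <;> simp [hb])
    (fun b hb => Pi.single_eq_of_ne (fun hba => hb (by rwa [hba])) 1)
  simpa [Pi.single_apply, ite_smul] using key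

theorem apply_vertex_of_notMem (h : IsFanCoordinate f 𝒦 W) (hs : s ∈ 𝒦) {a b : α}
    (ha : a ∈ s) (hb : b ∉ s) : W (f a) b = 0 := by
  classical
  rw [h.apply_vertex hs ha]
  exact Pi.single_eq_of_ne (fun hba => hb (by rwa [hba])) 1

theorem injOn_vertices (h : IsFanCoordinate f 𝒦 W) : Set.InjOn f {a | {a} ∈ 𝒦} := by
  classical
  intro a ha b hb hab
  have h1 := h.apply_vertex ha (Finset.mem_singleton_self a)
  rw [hab, h.apply_vertex hb (Finset.mem_singleton_self b)] at h1
  by_contra hne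
  simpa [Pi.single_apply, hne] using congrFun h1 a

/-! ### Cones and simplices in coordinates -/

theorem mem_hull_iff (h : IsFanCoordinate f 𝒦 W) (hs : s ∈ 𝒦) :
    x ∈ PointedCone.hull ℝ (f '' s) ↔ ∀ a ∉ s, W x a = 0 := by
  constructor
  · intro hx
    induction hx using Submodule.span_induction with
    | mem x hx =>
      obtain ⟨a, ha, rfl⟩ := hx
      exact fun b hb => h.apply_vertex_of_notMem hs ha hb
    | zero => simp [h.apply_zero]
    | add x y _ _ hx hy =>
      intro a ha
      simp [h.apply_add hs hx hy, hx a ha, hy a ha]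
    | smul c x _ hx =>
      intro a ha
      exact (congrFun (h.apply_smul c.2 x) a).trans (by
        rw [Pi.smul_apply, hx a ha, smul_zero])
  · intro hx
    rw [← h.sum_eq x]
    refine Submodule.sum_mem _ fun a _ => ?_
    by_cases ha : a ∈ s
    · exact PointedCone.smul_mem _ (h.nonneg x a)
        (PointedCone.subset_hull (Set.mem_image_of_mem f ha))
    · simp [hx a ha]

/-- The right-hand side describes a convex set because `W` is additive on the cone over `s`;
conversely, the coordinates themselves are the convex weights. -/
theorem mem_convexHull_iff (h : IsFanCoordinate f 𝒦 W) (hs : s ∈ 𝒦) :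
    x ∈ convexHull ℝ (f '' s) ↔ (∀ a ∉ s, W x a = 0) ∧ ∑ a, W x a = 1 := by
  classical
  constructor
  · intro hx
    refine convexHull_min (t := {x | (∀ a ∉ s, W x a = 0) ∧ ∑ a, W x a = 1}) ?_ ?_ hx
    · rintro _ ⟨a, ha, rfl⟩
      exact ⟨fun b hb => h.apply_vertex_of_notMem hs ha hb, by simp [h.apply_vertex hs ha]⟩
    · rintro x ⟨hx, hx1⟩ y ⟨hy, hy1⟩ p q hp hq hpq
      have hpx : ∀ a ∉ s, W (p • x) a = 0 := fun a ha => by simp [h.apply_smul hp, hx a ha]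
      have hqy : ∀ a ∉ s, W (q • y) a = 0 := fun a ha => by simp [h.apply_smul hq, hy a ha]
      have hW := h.apply_add hs hpx hqy
      refine ⟨fun a ha => by simp [hW, hpx a ha, hqy a ha], ?_⟩
      simp [hW, h.apply_smul hp, h.apply_smul hq, Finset.sum_add_distrib, ← Finset.mul_sum,
        hx1, hy1, hpq]
  · rintro ⟨hx, hx1⟩
    have hsum : ∀ {M : Type _} [AddCommMonoid M] (g : α → M), (∀ a ∉ s, g a = 0) →
        ∑ a ∈ s, g a = ∑ a, g a := fun g hg =>
      Finset.sum_subset (Finset.subset_univ s) fun a _ ha => hg a ha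
    rw [← h.sum_eq x, ← hsum _ fun a ha => by simp [hx a ha]]
    refine (convex_convexHull ℝ _).sum_mem (fun a _ => h.nonneg x a) ?_
      fun a ha => subset_convexHull ℝ _ (Set.mem_image_of_mem f ha)
    rw [Finset.sum_subset (Finset.subset_univ s) fun a _ ha => hx a ha, hx1]

/-- The positive and negative parts of a linear relation are two nonnegative representations of one
vector on `s`. By uniqueness they coincide, which forces all coefficients to vanish. -/
theorem linearIndepOn (h : IsFanCoordinate f 𝒦 W) (hs : s ∈ 𝒦) : LinearIndepOn ℝ f s := by
  classical
  rw [linearIndepOn_finset_iff]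
  intro g hg a ha
  have hp := h.apply_sum s hs (fun a => if a ∈ s then max (g a) 0 else 0)
    (fun a => by split_ifs <;> simp) (fun a ha => if_neg ha)
  have hn := h.apply_sum s hs (fun a => if a ∈ s then max (-g a) 0 else 0)
    (fun a => by split_ifs <;> simp) (fun a ha => if_neg ha)
  have heq : ∑ a, (if a ∈ s then max (g a) 0 else 0) • f a =
      ∑ a, (if a ∈ s then max (-g a) 0 else 0) • f a := by
    rw [← sub_eq_zero, ← Finset.sum_sub_distrib, ← hg]
    simp only [ite_smul, zero_smul, Finset.sum_sub_distrib, Finset.sum_ite_mem, Finset.univ_inter]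
    rw [← Finset.sum_sub_distrib]
    refine Finset.sum_congr rfl fun a _ => ?_
    rw [← sub_smul]
    congr 1
    rcases le_total 0 (g a) with h0 | h0 <;> simp [h0]
  rw [heq, hn] at hp
  have := congrFun hp a
  simp only [ha, if_true] at this
  rcases le_total 0 (g a) with h0 | h0 <;> simp [h0] at this <;> linarith

theorem linearIndepOn_image (h : IsFanCoordinate f 𝒦 W) (hs : s ∈ 𝒦) :
    LinearIndepOn ℝ id (f '' s) :=
  (h.linearIndepOn hs).id_image

theorem hull_inf_hull [DecidableEq α] (h : IsFanCoordinate f 𝒦 W) (hs : s ∈ 𝒦) (ht : t ∈ 𝒦) :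
    PointedCone.hull ℝ (f '' s) ⊓ PointedCone.hull ℝ (f '' t) =
      PointedCone.hull ℝ (f '' (s ∩ t : Finset α)) := by
  ext x
  rw [Submodule.mem_inf, h.mem_hull_iff hs, h.mem_hull_iff ht, h.mem_hull_iff (𝒦.lower Finset.inter_subset_left hs)]
  constructor
  · rintro ⟨h1, h2⟩ a ha
    by_cases has : a ∈ s
    · exact h2 a fun hat => ha (Finset.mem_inter.mpr ⟨has, hat⟩)
    · exact h1 a has
  · exact fun h1 => ⟨fun a ha => h1 a fun ha' => ha (Finset.mem_inter.mp ha').1,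
      fun a ha => h1 a fun ha' => ha (Finset.mem_inter.mp ha').2⟩

/-- Coordinates are nonnegative and additive on the cone over `s`, so one that vanishes on a sum
vanishes on each summand. -/
theorem hull_isFaceOf (h : IsFanCoordinate f 𝒦 W) (hs : s ∈ 𝒦) (hts : t ⊆ s) :
    (PointedCone.hull ℝ (f '' t)).IsFaceOf (PointedCone.hull ℝ (f '' s)) := by
  refine ⟨Submodule.span_mono (Set.image_mono hts), ?_⟩
  intro x y c hx hy hc hxy
  have ht := 𝒦.lower hts hs
  rw [h.mem_hull_iff hs] at hx hy
  rw [h.mem_hull_iff ht] at hxy ⊢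
  intro a ha
  have hW := h.apply_add hs (x := c • x) (fun a ha => by simp [h.apply_smul hc.le, hx a ha]) hy
  have h0 : c * W x a + W y a = 0 := by
    simpa [hW, h.apply_smul hc.le] using hxy a ha
  have h1 := mul_nonneg hc.le (h.nonneg x a)
  have h2 := h.nonneg y a
  exact (mul_eq_zero.mp (by linarith : c * W x a = 0)).resolve_left hc.ne'

/-- A face is spanned by the generators it contains: a generator with positive weight in a point of
`D` lies in `D` by the face property. -/
theorem eq_hull_of_isFaceOf (h : IsFanCoordinate f 𝒦 W) (hs : s ∈ 𝒦) {D : PointedCone ℝ V}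
    (hD : D.IsFaceOf (PointedCone.hull ℝ (f '' s))) :
    ∃ t ⊆ s, D = PointedCone.hull ℝ (f '' t) := by
  classical
  refine ⟨s.filter fun a => f a ∈ D, Finset.filter_subset _ _, le_antisymm ?_ ?_⟩
  · intro x hx
    have ht : s.filter (fun a => f a ∈ D) ∈ 𝒦 := 𝒦.lower (Finset.filter_subset _ _) hs
    have hxs := (h.mem_hull_iff hs).mp (hD.le hx)
    rw [h.mem_hull_iff ht]
    intro a ha
    by_contra hne
    have has : a ∈ s := by
      by_contra has
      exact hne (hxs a has)
    refine ha (Finset.mem_filter.mpr ⟨has, ?_⟩)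
    have hmem : ∀ b : s, f b ∈ PointedCone.hull ℝ (f '' s) := fun b =>
      PointedCone.subset_hull (Set.mem_image_of_mem f b.2)
    refine hD.mem_of_sum_smul_mem (f := fun b : s => f b) (c := fun b : s => W x b) hmem
      (fun b => h.nonneg x b) ?_ ⟨a, has⟩ (lt_of_le_of_ne (h.nonneg x a) (Ne.symm hne))
    have hsum : ∑ b : s, W x b • f b = x := by
      rw [Finset.sum_coe_sort s fun b => W x b • f b,
        Finset.sum_subset (Finset.subset_univ s) fun a _ ha => by simp [hxs a ha], h.sum_eq]
    rwa [hsum]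
  · refine Submodule.span_le.mpr ?_
    rintro _ ⟨a, ha, rfl⟩
    exact (Finset.mem_filter.mp ha).2

theorem isCompleteSimplicialFan (h : IsFanCoordinate f 𝒦 W) :
    IsCompleteSimplicialFan
      {C : PointedCone ℝ V | ∃ s ∈ 𝒦, C = PointedCone.hull ℝ (f '' (s : Set α))} where
  finite := by
    refine (Set.finite_range fun s : Finset α => PointedCone.hull ℝ (f '' (s : Set α))).subset ?_
    rintro _ ⟨s, -, rfl⟩
    exact ⟨s, rfl⟩
  simplicial := by
    rintro _ ⟨s, hs, rfl⟩
    exact .hull (s.finite_toSet.image f) (h.linearIndepOn_image hs)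
  face_mem := by
    rintro _ ⟨s, hs, rfl⟩ D hD
    obtain ⟨t, hts, rfl⟩ := h.eq_hull_of_isFaceOf hs hD
    exact ⟨t, 𝒦.lower hts hs, rfl⟩
  inter := by
    classical
    rintro _ ⟨s, hs, rfl⟩ _ ⟨t, ht, rfl⟩
    rw [h.hull_inf_hull hs ht]
    exact ⟨h.hull_isFaceOf hs Finset.inter_subset_left,
      h.hull_isFaceOf ht Finset.inter_subset_right, _, 𝒦.lower Finset.inter_subset_left hs, rfl⟩
  cover x := by
    obtain ⟨s, hs, hx⟩ := h.exists_support x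
    exact ⟨_, ⟨s, hs, rfl⟩, (h.mem_hull_iff hs).mpr hx⟩

/-- The geometric simplicial complex of all simplices `Conv (f '' s)`, for nonempty faces `s`. -/
def toSimplicialComplex (h : IsFanCoordinate f 𝒦 W) : Geometry.SimplicialComplex ℝ V where
  faces := {t : Finset V | ∃ s ∈ 𝒦, s.Nonempty ∧ (t : Set V) = f '' (s : Set α)}
  isRelLowerSet_faces := by
    classical
    rintro t ⟨s, hs, hne, hts⟩
    refine ⟨?_, fun u hut hu => ?_⟩
    · rw [← Finset.coe_nonempty, hts]
      exact (Finset.coe_nonempty.mpr hne).image f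
    -- A subset of the vertices is realized by the labels that `f` sends into it, which form a
    -- subset of `s`.
    · have himg : (u : Set V) = f '' (s.filter fun a => f a ∈ u : Finset α) := by
        ext x
        constructor
        · intro hx
          obtain ⟨a, ha, rfl⟩ : x ∈ f '' (s : Set α) := hts ▸ hut hx
          exact ⟨a, by simpa using ⟨ha, hx⟩, rfl⟩
        · rintro ⟨a, ha, rfl⟩
          exact (Finset.mem_filter.mp ha).2
      refine ⟨_, 𝒦.lower (Finset.filter_subset _ _) hs, ?_, himg⟩
      rw [← Finset.coe_nonempty, himg, Set.image_nonempty] at hu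
      exact Finset.coe_nonempty.mp hu
  indep := by
    rintro t ⟨s, hs, -, hts⟩
    have hli : LinearIndepOn ℝ id (t : Set V) := hts ▸ h.linearIndepOn_image hs
    exact LinearIndependent.affineIndependent (k := ℝ) hli
  inter_subset_convexHull := by
    classical
    rintro t₁ t₂ ⟨s₁, hs₁, -, hts₁⟩ ⟨s₂, hs₂, -, hts₂⟩ x ⟨hx₁, hx₂⟩
    rw [hts₁, h.mem_convexHull_iff hs₁] at hx₁
    rw [hts₂, h.mem_convexHull_iff hs₂] at hx₂
    have hx : x ∈ convexHull ℝ (f '' (s₁ ∩ s₂ : Finset α)) := by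
      refine (h.mem_convexHull_iff (𝒦.lower Finset.inter_subset_left hs₁)).mpr ⟨fun a ha => ?_, hx₁.2⟩
      by_cases ha₁ : a ∈ s₁
      · exact hx₂.1 a fun ha₂ => ha (Finset.mem_inter.mpr ⟨ha₁, ha₂⟩)
      · exact hx₁.1 a ha₁
    rw [hts₁, hts₂]
    refine convexHull_mono ?_ hx
    rw [Finset.coe_inter]
    exact Set.image_inter_subset f _ _

theorem isGeometricRealization (h : IsFanCoordinate f 𝒦 W) :
    IsGeometricRealization {C | ∃ s ∈ 𝒦, C = convexHull ℝ (f '' (s : Set α))} 𝒦 f := by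
  classical
  refine ⟨h.toSimplicialComplex, ?_, h.injOn_vertices, rfl⟩
  ext C
  constructor
  · rintro ⟨⟨s, hs, rfl⟩, hne⟩
    refine ⟨s.image f, ⟨s, hs, ?_, Finset.coe_image⟩, by simp⟩
    rw [Finset.nonempty_iff_ne_empty]
    rintro rfl
    simp at hne
  · rintro ⟨t, ⟨s, hs, hne, hts⟩, rfl⟩
    refine ⟨⟨s, hs, by simp only [hts]⟩, ?_⟩
    simpa [hts, Finset.nonempty_iff_ne_empty] using hne

theorem mem_sUnion_iff (h : IsFanCoordinate f 𝒦 W) :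
    x ∈ ⋃₀ {C | ∃ s ∈ 𝒦, C = convexHull ℝ (f '' (s : Set α))} ↔ ∑ a, W x a = 1 := by
  constructor
  · rintro ⟨_, ⟨s, hs, rfl⟩, hx⟩
    exact ((h.mem_convexHull_iff hs).mp hx).2
  · intro hx
    obtain ⟨s, hs, hxs⟩ := h.exists_support x
    exact ⟨_, ⟨s, hs, rfl⟩, (h.mem_convexHull_iff hs).mpr ⟨hxs, hx⟩⟩

theorem sum_smul (h : IsFanCoordinate f 𝒦 W) {c : ℝ} (hc : 0 ≤ c) (x : V) :
    ∑ a, W (c • x) a = c * ∑ a, W x a := by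
  simp [h.apply_smul hc, Finset.mul_sum]

theorem sum_pos (h : IsFanCoordinate f 𝒦 W) (hx : x ≠ 0) : 0 < ∑ a, W x a := by
  refine (Finset.sum_nonneg fun a _ => h.nonneg x a).lt_of_ne' fun h0 => hx ?_
  rw [Finset.sum_eq_zero_iff_of_nonneg fun a _ => h.nonneg x a] at h0
  rw [← h.sum_eq x]
  exact Finset.sum_eq_zero fun a ha => by simp [h0 a ha]

end Module

/-! ### Radial projection and the starshaped sphere -/

variable {α V : Type*} [Fintype α] [NormedAddCommGroup V] [NormedSpace ℝ V]
  {f : α → V} {𝒦 : LowerSet (Finset α)} {W : V → α → ℝ}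

/-- The radial projection of the unit level set of the sum of the coordinates onto the sphere. -/
noncomputable def homeomorphSphere (h : IsFanCoordinate f 𝒦 W) (hW : Continuous W) :
    {x | ∑ a, W x a = 1} ≃ₜ Metric.sphere (0 : V) 1 where
  toFun x := ⟨‖(x : V)‖⁻¹ • (x : V), by
    have hx : (x : V) ≠ 0 := fun h0 => by simpa [h0, h.apply_zero] using x.2
    simp [norm_smul, hx]⟩
  invFun v := ⟨(∑ a, W v a)⁻¹ • (v : V), by
    have hv := h.sum_pos (ne_zero_of_mem_unit_sphere v)
    change ∑ a, W _ a = 1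
    rw [h.sum_smul (inv_nonneg.mpr hv.le), inv_mul_cancel₀ hv.ne']⟩
  left_inv x := by
    have hx : (x : V) ≠ 0 := fun h0 => by simpa [h0, h.apply_zero] using x.2
    have h1 : ∑ a, W x a = 1 := x.2
    ext
    simp only [h.sum_smul (inv_nonneg.mpr (norm_nonneg (x : V))), h1, mul_one, inv_inv]
    rw [smul_inv_smul₀ (norm_ne_zero_iff.mpr hx)]
  right_inv v := by
    have hv := h.sum_pos (ne_zero_of_mem_unit_sphere v)
    ext
    simp only [norm_smul, norm_inv, Real.norm_of_nonneg hv.le, norm_eq_of_mem_sphere, mul_one,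
      inv_inv]
    rw [smul_inv_smul₀ hv.ne']
  continuous_toFun := by
    refine Continuous.subtype_mk ?_ _
    refine (continuous_subtype_val.norm.inv₀ fun x h0 => ?_).smul continuous_subtype_val
    simpa [norm_eq_zero.mp h0, h.apply_zero] using x.2
  continuous_invFun := by
    refine Continuous.subtype_mk ?_ _
    refine Continuous.smul (Continuous.inv₀ ?_ fun v => ?_) continuous_subtype_val
    · exact continuous_finsetSum _ fun a _ =>
        (continuous_apply a).comp (hW.comp continuous_subtype_val)
    · exact (h.sum_pos (ne_zero_of_mem_unit_sphere v)).ne'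

/-- By homogeneity, `∑ W` of a point `p • x` with `x` in the level set is `p`. A common point of two
segments therefore has the same parameter on both, and a nonzero parameter forces `x = y`. -/
theorem isStarshapedSphere (h : IsFanCoordinate f 𝒦 W) (hW : Continuous W) :
    IsStarshapedSphere 0 (⋃₀ {C | ∃ s ∈ 𝒦, C = convexHull ℝ (f '' (s : Set α))}) := by
  have hX : ⋃₀ {C | ∃ s ∈ 𝒦, C = convexHull ℝ (f '' (s : Set α))} = {x | ∑ a, W x a = 1} :=
    Set.ext fun x => h.mem_sUnion_iff
  rw [hX]
  refine ⟨⟨h.homeomorphSphere hW⟩, by simp [h.apply_zero], ?_⟩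
  intro x hx y hy hxy
  refine Set.Subset.antisymm ?_ (Set.singleton_subset_iff.mpr
    ⟨left_mem_segment ℝ 0 x, left_mem_segment ℝ 0 y⟩)
  rintro z ⟨⟨_, p, _, hp, _, hz⟩, ⟨_, q, _, hq, _, hz'⟩⟩
  rw [smul_zero, zero_add] at hz hz'
  have hzp := h.sum_smul hp x
  have hzq := h.sum_smul hq y
  rw [hz, show ∑ a, W x a = 1 from hx, mul_one] at hzp
  rw [hz', show ∑ a, W y a = 1 from hy, mul_one] at hzq
  have hpq : p = q := hzp.symm.trans hzq
  subst hpq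
  rcases eq_or_ne p 0 with rfl | hp0
  · simpa using hz.symm
  · exact absurd (smul_right_injective V hp0 (hz.trans hz'.symm)) hxy

end IsFanCoordinate

/-! ### The level of a vector with respect to a complex -/

/-- The complex `K` contains the strict superlevel set of `y` at `c`, but not the weak one. -/
def IsLevel {n : ℕ} (K : LowerSet (Finset (Fin n))) (y : Fin n → ℝ) (c : ℝ) : Prop :=
  Finset.univ.filter (fun i => c < y i) ∈ K ∧ Finset.univ.filter (fun i => c ≤ y i) ∉ K

variable {n : ℕ} {K : LowerSet (Finset (Fin n))}

theorem univ_notMem (hproper : K ≠ ⊤) : Finset.univ ∉ K := fun h =>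
  hproper (eq_top_iff.mpr fun A _ => K.lower (Finset.subset_univ A) h)

/-- The level is the largest entry of `y` whose weak superlevel set is not in `K`. Were the strict
superlevel set outside `K` too, it would be nonempty and its least entry would be a larger
candidate. -/
theorem exists_isLevel (hempty : ∅ ∈ K) (hproper : K ≠ ⊤) (y : Fin n → ℝ) :
    ∃ c, IsLevel K y c := by
  classical
  have hmin : ∀ A ∉ K, ∃ j ∈ A, ∀ i ∈ A, y j ≤ y i := fun A hA =>
    A.exists_min_image y (Finset.nonempty_iff_ne_empty.mpr fun h => hA (h ▸ hempty))
  let P := Finset.univ.filter fun j => Finset.univ.filter (fun i => y j ≤ y i) ∉ K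
  have hP : P.Nonempty := by
    obtain ⟨j, -, hj⟩ := hmin _ (univ_notMem hproper)
    refine ⟨j, Finset.mem_filter.mpr ⟨Finset.mem_univ j, ?_⟩⟩
    rw [Finset.filter_true_of_mem hj]
    exact univ_notMem hproper
  obtain ⟨k, hk, hmax⟩ := P.exists_max_image y hP
  refine ⟨y k, ?_, (Finset.mem_filter.mp hk).2⟩
  by_contra hnot
  obtain ⟨j, hj, hjmin⟩ := hmin _ hnot
  have hkj : y k < y j := (Finset.mem_filter.mp hj).2
  refine absurd (hmax j (Finset.mem_filter.mpr ⟨Finset.mem_univ j, fun h => hnot ?_⟩)) hkj.not_ge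
  exact K.lower (fun i hi => Finset.mem_filter.mpr ⟨Finset.mem_univ i, hjmin i hi⟩) h

/-- If `d > c + ε`, the weak superlevel set of `z` at `d` would lie in the strict one of `y` at `c`,
hence in `K`. Taking `ε = 0` gives uniqueness, and `ε = dist x y` gives the Lipschitz bound. -/
theorem IsLevel.le_add {y z : Fin n → ℝ} {c d ε : ℝ} (hc : IsLevel K y c) (hd : IsLevel K z d)
    (h : ∀ i, z i ≤ y i + ε) : d ≤ c + ε := by
  by_contra! hlt
  refine hd.2 (K.lower (fun i hi => ?_) hc.1)
  have hi' : d ≤ z i := (Finset.mem_filter.mp hi).2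
  exact Finset.mem_filter.mpr ⟨Finset.mem_univ i, by linarith [h i]⟩

theorem IsLevel.unique {y : Fin n → ℝ} {c d : ℝ} (hc : IsLevel K y c) (hd : IsLevel K y d) :
    c = d := by
  refine le_antisymm ?_ ?_
  · simpa using hd.le_add hc (ε := 0) (by simp)
  · simpa using hc.le_add hd (ε := 0) (by simp)

theorem continuous_of_isLevel {c : H0 n → ℝ}
    (hc : ∀ x : H0 n, IsLevel K (x : EuclideanSpace ℝ (Fin n)) (c x)) : Continuous c := by
  have hdist : ∀ (x y : H0 n) (i : Fin n),
      |(x : EuclideanSpace ℝ (Fin n)) i - (y : EuclideanSpace ℝ (Fin n)) i| ≤ dist x y := by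
    intro x y i
    rw [Subtype.dist_eq, dist_eq_norm]
    exact PiLp.norm_apply_le ((x : EuclideanSpace ℝ (Fin n)) - (y : EuclideanSpace ℝ (Fin n))) i
  refine (LipschitzWith.of_le_add fun x y => ?_).continuous
  exact (hc y).le_add (hc x) fun i => by linarith [(abs_le.mp (hdist x y i)).2]

/-! ### The coordinates of the canonical fan -/

theorem delta_apply (i j : Fin n) :
    (delta i : EuclideanSpace ℝ (Fin n)) j = (if j = i then 1 else 0) - (n : ℝ)⁻¹ := by
  simp [delta, allOnes, Pi.single_apply]

theorem sum_smul_delta_apply (a : Fin n → ℝ) (j : Fin n) :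
    ((∑ i, a i • delta i : H0 n) : EuclideanSpace ℝ (Fin n)) j = a j - (n : ℝ)⁻¹ * ∑ i, a i := by
  simp [delta_apply, mul_sub, Finset.sum_sub_distrib, ← Finset.sum_mul, mul_comm]

theorem sum_smul_delta_sub_const (x : H0 n) (c : ℝ) :
    ∑ i, ((x : EuclideanSpace ℝ (Fin n)) i - c) • delta i = x := by
  have hx : ∑ i, (x : EuclideanSpace ℝ (Fin n)) i = 0 := x.2
  ext j
  have hn : (n : ℝ) ≠ 0 := Nat.cast_ne_zero.mpr j.pos.ne'
  rw [sum_smul_delta_apply, Finset.sum_sub_distrib, hx]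
  simp [hn]

theorem sum_delta : ∑ i : Fin n, delta i = 0 := by
  -- For `x = 0` and `c = -1` every coefficient equals `1`.
  have h := sum_smul_delta_sub_const (0 : H0 n) (-1)
  simpa using h

theorem sum_elim_delta (w : Fin n ⊕ Fin n → ℝ) :
    ∑ a, w a • Sum.elim delta (fun i => -delta i) a =
      ∑ i, (w (Sum.inl i) - w (Sum.inr i)) • delta i := by
  simp [sub_smul, Finset.sum_sub_distrib, ← sub_eq_add_neg]

theorem exists_isFanCoordinate (hempty : ∅ ∈ K) (hproper : K ≠ ⊤) :
    ∃ W : H0 n → Fin n ⊕ Fin n → ℝ, Continuous W ∧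
      IsFanCoordinate (Sum.elim delta fun i => -delta i) (bier K) W := by
  choose c hc using fun x : H0 n =>
    exists_isLevel hempty hproper (x : EuclideanSpace ℝ (Fin n))
  refine ⟨fun x => Sum.elim (fun i => max ((x : EuclideanSpace ℝ (Fin n)) i - c x) 0)
    (fun i => max (c x - (x : EuclideanSpace ℝ (Fin n)) i) 0), ?_, ?_, ?_, ?_, ?_⟩
  · have hcont := continuous_of_isLevel hc
    refine continuous_pi fun a => ?_
    rcases a with i | i <;> simp only [Sum.elim_inl, Sum.elim_inr] <;> fun_prop
  · rintro x (i | i) <;> simp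
  · intro x
    -- The indices with `xᵢ = c x` lie in neither part, as both of their coefficients vanish.
    refine ⟨(Finset.univ.filter fun i => c x < (x : EuclideanSpace ℝ (Fin n)) i).disjSum
      (Finset.univ.filter fun i => c x ≤ (x : EuclideanSpace ℝ (Fin n)) i)ᶜ,
      mem_deletedJoin_iff.mpr ⟨_, (hc x).1, _, ?_, ?_, rfl⟩, ?_⟩
    · change _ᶜ ∉ K
      rw [compl_compl]
      exact (hc x).2
    · rw [Finset.disjoint_left]
      intro i hi hi'
      simp only [Finset.mem_filter, Finset.mem_compl, Finset.mem_univ, true_and] at hi hi'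
      exact hi' hi.le
    · rintro (i | i) hi
      · simpa using hi
      · simpa using hi
  · intro x
    rw [sum_elim_delta]
    refine Eq.trans (Finset.sum_congr rfl fun i _ => ?_) (sum_smul_delta_sub_const x (c x))
    simp only [Sum.elim_inl, Sum.elim_inr]
    congr 1
    rcases le_total (c x) ((x : EuclideanSpace ℝ (Fin n)) i) with h | h <;> simp [h]
  · rintro s ⟨hs1, hs2, hs3⟩ w hw hws
    have hx : ∀ j, ((∑ a, w a • Sum.elim delta (fun i => -delta i) a : H0 n) :
        EuclideanSpace ℝ (Fin n)) j = w (Sum.inl j) - w (Sum.inr j) -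
          (n : ℝ)⁻¹ * ∑ i, (w (Sum.inl i) - w (Sum.inr i)) := fun j => by
      rw [sum_elim_delta, sum_smul_delta_apply]
    set x : H0 n := ∑ a, w a • Sum.elim delta (fun i => -delta i) a
    set m := (n : ℝ)⁻¹ * ∑ i, (w (Sum.inl i) - w (Sum.inr i))
    have hl : ∀ j, j ∉ s.toLeft → w (Sum.inl j) = 0 := fun j hj => hws _ (by simpa using hj)
    have hr : ∀ j, j ∉ s.toRight → w (Sum.inr j) = 0 := fun j hj => hws _ (by simpa using hj)
    -- Entry `j` of `x` is the left weight minus the right weight minus `m`. Hence it exceeds `-m`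
    -- only on the left part of `s`, and it is at least `-m` off the right part.
    have hlevel : IsLevel K (x : EuclideanSpace ℝ (Fin n)) (-m) := by
      constructor
      · refine K.lower (fun j hj => ?_) hs1
        by_contra hjs
        have h1 := (Finset.mem_filter.mp hj).2
        rw [hx, hl j hjs] at h1
        linarith [hw (Sum.inr j)]
      · refine fun h => hs2 (K.lower (fun j hj => ?_) h)
        refine Finset.mem_filter.mpr ⟨Finset.mem_univ j, ?_⟩
        rw [hx, hr j (Finset.mem_compl.mp hj)]
        linarith [hw (Sum.inl j)]
    have hcx : c x = -m := (hc x).unique hlevel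
    funext a
    rcases a with j | j <;> simp only [Sum.elim_inl, Sum.elim_inr, hcx, hx]
    · by_cases hj : j ∈ s.toLeft
      · rw [hr j (Finset.disjoint_left.mp hs3 hj)]
        simpa using hw (Sum.inl j)
      · rw [hl j hj, max_eq_right]
        linarith [hw (Sum.inr j)]
    · by_cases hj : j ∈ s.toRight
      · rw [hl j (Finset.disjoint_right.mp hs3 hj)]
        refine (max_eq_left ?_).trans ?_ <;> linarith [hw (Sum.inr j)]
      · rw [hr j hj, max_eq_right]
        linarith [hw (Sum.inl j)]

theorem canonicalRealization_eq (K : LowerSet (Finset (Fin n))) :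
    canonicalRealization K = {C | ∃ s ∈ bier K,
      C = convexHull ℝ (Sum.elim delta (fun i => -delta i) '' (s : Set (Fin n ⊕ Fin n)))} := by
  have himg : ∀ s : Finset (Fin n ⊕ Fin n), convexHull ℝ
      (realizedSimplex delta s.toLeft ∪ realizedSimplex (fun i => -delta i) s.toRight) =
      convexHull ℝ (Sum.elim delta (fun i => -delta i) '' (s : Set (Fin n ⊕ Fin n))) := by
    intro s
    rw [realizedSimplex, realizedSimplex, convexHull_convexHull_union_left,
      convexHull_convexHull_union_right]
    congr 1
    ext x
    simp
  simp only [canonicalRealization, himg]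

theorem hull_convexHull {V : Type*} [AddCommGroup V] [Module ℝ V] (s : Set V) :
    PointedCone.hull ℝ (convexHull ℝ s) = PointedCone.hull ℝ s :=
  le_antisymm
    (Submodule.span_le.mpr
      (convexHull_min PointedCone.subset_hull (PointedCone.convex (PointedCone.hull ℝ s))))
    (Submodule.span_mono (subset_convexHull ℝ s))

theorem coneFamily_eq (K : LowerSet (Finset (Fin n))) :
    coneFamily K = {C | ∃ s ∈ bier K, C = PointedCone.hull ℝ
      (Sum.elim delta (fun i => -delta i) '' (s : Set (Fin n ⊕ Fin n)))} := by
  rw [coneFamily, canonicalRealization_eq]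
  ext C
  constructor
  · rintro ⟨_, ⟨s, hs, rfl⟩, rfl⟩
    exact ⟨s, hs, hull_convexHull _⟩
  · rintro ⟨s, hs, rfl⟩
    exact ⟨_, ⟨s, hs, rfl⟩, hull_convexHull _⟩

/-! ### The shore subdivision -/

/-- Since the `δᵢ` sum to zero, the negated sum over `B` is the sum over `Bᶜ`; the factor only
adjusts the two cardinalities. -/
theorem barycenter_neg_delta {B : Finset (Fin n)} (hB : B ≠ Finset.univ) :
    barycenter (fun i => -delta i) B = ((B.card : ℝ)⁻¹ * Bᶜ.card) • barycenter delta Bᶜ := by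
  have hc : (Bᶜ.card : ℝ) ≠ 0 := by
    simpa [Finset.compl_eq_empty_iff] using hB
  have hsum : ∑ i ∈ B, -delta i = ∑ i ∈ Bᶜ, delta i := by
    rw [Finset.sum_neg_distrib, neg_eq_iff_add_eq_zero, Finset.sum_add_sum_compl, sum_delta]
  rw [barycenter, barycenter, hsum, smul_smul, mul_assoc, mul_inv_cancel₀ hc, mul_one]

theorem hull_barycenter_neg_delta {𝒯 : Set (Finset (Fin n))}
    (h𝒯 : ∀ B ∈ 𝒯, B.Nonempty ∧ B ≠ Finset.univ) :
    PointedCone.hull ℝ (barycenter (fun i => -delta i) '' 𝒯) =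
      PointedCone.hull ℝ (barycenter delta '' (compl '' 𝒯)) := by
  rw [Set.image_image]
  refine le_antisymm (Submodule.span_le.mpr ?_) (Submodule.span_le.mpr ?_)
  · rintro _ ⟨B, hB, rfl⟩
    rw [barycenter_neg_delta (h𝒯 B hB).2]
    exact PointedCone.smul_mem _ (by positivity) (PointedCone.subset_hull ⟨B, hB, rfl⟩)
  · rintro _ ⟨B, hB, rfl⟩
    have hB1 : (0 : ℝ) < B.card := by exact_mod_cast (h𝒯 B hB).1.card_pos
    have hB2 : (0 : ℝ) < Bᶜ.card := by
      have : Bᶜ.Nonempty := by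
        rw [Finset.nonempty_iff_ne_empty, Ne, Finset.compl_eq_empty_iff]
        exact (h𝒯 B hB).2
      exact_mod_cast this.card_pos
    have hpos : 0 < (B.card : ℝ)⁻¹ * Bᶜ.card := by positivity
    have heq : barycenter delta Bᶜ = ((B.card : ℝ)⁻¹ * Bᶜ.card)⁻¹ •
        barycenter (fun i => -delta i) B := by
      rw [barycenter_neg_delta (h𝒯 B hB).2, inv_smul_smul₀ hpos.ne']
    simp only [heq]
    exact PointedCone.smul_mem _ (by positivity) (PointedCone.subset_hull ⟨B, hB, rfl⟩)

theorem hull_barycenter_union {𝒮 𝒯 : Set (Finset (Fin n))}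
    (h𝒯 : ∀ B ∈ 𝒯, B.Nonempty ∧ B ≠ Finset.univ) :
    PointedCone.hull ℝ (barycenter delta '' 𝒮 ∪ barycenter (fun i => -delta i) '' 𝒯) =
      PointedCone.hull ℝ (barycenter delta '' (𝒮 ∪ compl '' 𝒯)) := by
  rw [Set.image_union, PointedCone.hull, PointedCone.hull, Submodule.span_union,
    Submodule.span_union]
  congr 1
  exact hull_barycenter_neg_delta h𝒯

/-- A member of maximal cardinality is the top of a finite chain; `∅` serves for the empty chain. -/
theorem exists_mem_forall_subset_of_isChain {L : LowerSet (Finset (Fin n))} (hempty : ∅ ∈ L)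
    {𝒞 : Set (Finset (Fin n))} (h𝒞 : IsChain (· ⊆ ·) 𝒞) (hL : 𝒞 ⊆ L) :
    ∃ S ∈ L, (S = ∅ ∨ S ∈ 𝒞) ∧ ∀ A ∈ 𝒞, A ⊆ S := by
  rcases 𝒞.eq_empty_or_nonempty with rfl | hne
  · exact ⟨∅, hempty, Or.inl rfl, by simp⟩
  · obtain ⟨S, hS, hmax⟩ := 𝒞.toFinite.exists_maximalFor Finset.card 𝒞 hne
    refine ⟨S, hL hS, Or.inr hS, fun A hA => ?_⟩
    rcases h𝒞.total hA hS with h | h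
    · exact h
    · exact (Finset.eq_of_subset_of_card_le h (hmax hA (Finset.card_le_card h))).ge

theorem shoreSubdivision_eq (hempty : ∅ ∈ K) (hproper : K ≠ ⊤) :
    shoreSubdivision K = barycentricFan n := by
  have huniv := univ_notMem hproper
  ext C
  constructor
  · rintro ⟨s, ⟨hs1, hs2, hs3⟩, 𝒮, 𝒯, h𝒮, h𝒮s, h𝒯, h𝒯s, rfl⟩
    have h𝒯' : ∀ B ∈ 𝒯, B.Nonempty ∧ B ≠ Finset.univ := fun B hB => by
      refine ⟨(h𝒯s B hB).1, ?_⟩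
      rintro rfl
      refine hs2 ?_
      rw [Finset.univ_subset_iff.mp (h𝒯s _ hB).2, Finset.compl_univ]
      exact hempty
    refine ⟨𝒮 ∪ compl '' 𝒯, ?_, ?_, hull_barycenter_union h𝒯'⟩
    -- Disjointness of the two parts of the face places every member of `𝒮` below every complement
    -- of a member of `𝒯`, so the union remains a chain.
    · have hcross : ∀ A ∈ 𝒮, ∀ B ∈ 𝒯, A ⊆ Bᶜ := fun A hA B hB =>
        (hs3.mono (h𝒮s A hA).2 (h𝒯s B hB).2).le_compl_right
      rintro A (hA | ⟨B, hB, rfl⟩) A' (hA' | ⟨B', hB', rfl⟩) hne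
      · exact h𝒮 hA hA' hne
      · exact Or.inl (hcross A hA B' hB')
      · exact Or.inr (hcross A' hA' B hB)
      · simp only [Finset.compl_subset_compl]
        exact (h𝒯.total hB hB').symm
    · rintro A (hA | ⟨B, hB, rfl⟩)
      · refine ⟨(h𝒮s A hA).1, ?_⟩
        rintro rfl
        exact huniv (K.lower (h𝒮s _ hA).2 hs1)
      · rw [Finset.nonempty_iff_ne_empty, Ne, Finset.compl_eq_empty_iff, Ne,
          Finset.compl_eq_univ_iff]
        exact ⟨(h𝒯' B hB).2, (h𝒯' B hB).1.ne_empty⟩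
  · rintro ⟨𝒜, h𝒜, h𝒜s, rfl⟩
    have h𝒯chain : IsChain (· ⊆ ·) {B : Finset (Fin n) | Bᶜ ∈ 𝒜 ∧ Bᶜ ∉ K} := by
      intro B hB B' hB' _
      have := h𝒜.total hB.1 hB'.1
      simp only [Finset.compl_subset_compl] at this
      exact this.symm
    obtain ⟨S, hSK, hS𝒜, hS⟩ := exists_mem_forall_subset_of_isChain hempty
      (h𝒜.mono (Set.inter_subset_left (t := (K : Set (Finset (Fin n)))))) Set.inter_subset_right
    obtain ⟨T, hTK, hT𝒜, hT⟩ := exists_mem_forall_subset_of_isChain (L := alexanderDual K)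
      (show ∅ᶜ ∉ K by simpa using huniv) h𝒯chain fun B hB => hB.2
    -- When both are chain members, `S` and `Tᶜ` are comparable. `Tᶜ ⊆ S` would put `Tᶜ` into `K`,
    -- so `S ⊆ Tᶜ`.
    have hST : Disjoint S T := by
      rcases hS𝒜 with rfl | hS𝒜
      · simp
      rcases hT𝒜 with rfl | hT𝒜
      · simp
      refine Finset.disjoint_left.mpr fun i hi hiT => ?_
      rcases h𝒜.total hS𝒜.1 hT𝒜.1 with h | h
      · exact Finset.mem_compl.mp (h hi) hiT
      · exact hT𝒜.2 (K.lower h hSK)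
    refine ⟨S.disjSum T, mem_deletedJoin_iff.mpr ⟨S, hSK, T, hTK, hST, rfl⟩, 𝒜 ∩ K,
      {B | Bᶜ ∈ 𝒜 ∧ Bᶜ ∉ K}, h𝒜.mono Set.inter_subset_left, ?_, h𝒯chain, ?_, ?_⟩
    · intro A hA
      exact ⟨(h𝒜s A hA.1).1, by simpa using hS A hA⟩
    · intro B hB
      refine ⟨?_, by simpa using hT B hB⟩
      have := (h𝒜s _ hB.1).2
      rwa [Ne, Finset.compl_eq_univ_iff, ← Ne, ← Finset.nonempty_iff_ne_empty] at this
    · rw [hull_barycenter_union]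
      · congr 2
        ext A
        constructor
        · intro hA
          by_cases hAK : A ∈ K
          · exact Or.inl ⟨hA, hAK⟩
          · exact Or.inr ⟨Aᶜ, by simpa using ⟨hA, hAK⟩, compl_compl A⟩
        · rintro (hA | ⟨B, hB, rfl⟩)
          · exact hA.1
          · exact hB.1
      · intro B hB
        have := h𝒜s _ hB.1
        rw [Finset.nonempty_iff_ne_empty, Ne, Finset.compl_eq_empty_iff, Ne,
          Finset.compl_eq_univ_iff] at this
        exact ⟨Finset.nonempty_iff_ne_empty.mpr this.2, this.1⟩

end BierSphere

theorem mainTheorem3 (n : ℕ) (K : LowerSet (Finset (Fin n))) (hempty : ∅ ∈ K) (hproper : K ≠ ⊤) :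
    BierSphere.IsGeometricRealization (BierSphere.canonicalRealization K) (BierSphere.bier K)
      (Sum.elim BierSphere.delta (fun i => -BierSphere.delta i)) ∧
    BierSphere.IsStarshapedSphere 0 (⋃₀ BierSphere.canonicalRealization K) ∧
    BierSphere.IsCompleteSimplicialFan (BierSphere.coneFamily K) ∧
    BierSphere.shoreSubdivision K = BierSphere.barycentricFan n := by
  obtain ⟨W, hW, h⟩ := BierSphere.exists_isFanCoordinate hempty hproper
  rw [BierSphere.canonicalRealization_eq, BierSphere.coneFamily_eq]
  exact ⟨h.isGeometricRealization, h.isStarshapedSphere hW, h.isCompleteSimplicialFan,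
    BierSphere.shoreSubdivision_eq hempty hproper⟩
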